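/- **Setting.** Let $\Psi$ be a task-motion domain. It consists of a set of states $S$, a set of actions $A$, a transition function $\gamma:S\times A\to S$, a start state $s_0$ and goal states $S_g\subseteq S$; a configuration space $C\subset\mathbb R^d$ that is bounded and convex and has nonempty interior; a Boolean collision test $f$ with $C_{free}=\{q\in C: f(q)=1\}$; a map $\varphi$ giving for each state the set of configurations that realize it; a map $\xi$ giving for each action the set of configurations admissible during it; and a start configuration $q_0$. A *solution* is a sequence of actions $a_0,\dots,a_n$ with continuous $\tau_0,\dots,\tau_n:[0,1]\to C_{free}$ such that $s_{i+1}=\gamma(s_i,a_i)$, $s_{n+1}\in S_g$, $\tau_0(0)=q_0$, $\tau_i(0)\in\varphi(s_i)$, $\tau_i(1)\in\varphi(s_{i+1})$, $\tau_{i+1}(0)=\tau_i(1)$, and $\tau_i$ takes values in $\xi(a_i)$. It *has clearance* if for some $\delta>0$ and every $i$, all points of $C$ at distance $<\delta$ from $\tau_i([0,1])$ lie in $C_{free}\cap\xi(a_i)$, and all points of $C$ at distance $<\delta$ from $\tau_i(1)$ lie in $\varphi(s_{i+1})$. (If $C_{free}$ and all $\varphi(s)$, $\xi(a)$ are open in $C$,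 every solution has clearance.) **AND/OR graph network.** Let $\Gamma=(G_0^a,G_1^a,\dots)$ be a sequence of augmented AND/OR graphs on a common finite set of nodes and hyper-arcs. Each hyper-arc leads from a set of child nodes to a parent node and carries a finite sequence of actions and a cost; each node carries a set of states that satisfy it; the augmented node (the current configuration) is satisfied by all states, is never the parent of a hyper-arc, and is the only child of each augmented hyper-arc. Some nodes that are children of no hyper-arc are labelled *success* (only goal states satisfy them) or *failure* (no node has both labels). A hyper-arc carries at least one action, except that an augmented hyper-arc not leading to a success node may carry none. A graph is entered with only its augmented node achieved. A hyper-arc is *feasible* if all its children are achieved and satisfied by the current state and its parent is not yet achieved. It is traversed by performing its actions; the traversal counts if the resulting state satisfies the parent, which then becomes achieved. Reaching a success node solves the network; reaching a failure node leads to the next graph, with the current state; a graph that still has a feasible hyper-arc may also be given up for the next one, with the current state. $\Gamma$ *contains* a sequence of actions within depth $l$ if performing these actions solves $\Gamma$ from $s_0$ in this way, starting in $G_0^a$ and using at most $l$ graphs. **Algorithm.** TMP-IDAN with depth limit $l$ and motion planning time $t$ searches $\Gamma$ with backtracking, starting in $G_0^a$ from $(s_0,q_0)$ and using at most $l$ graphs.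 In the current graph it tries the feasible hyper-arcs in order of cost; if none leads to a solution it goes on with the next graph from the current state and configuration; if there is no feasible hyper-arc this branch of the search ends. For each action $a$ of a hyper-arc, in state $s$ and configuration $q$, it runs RRT for $t$ iterations from $q$ in the free set $C_{free}\cap\xi(a)$ and tries, in order of a given cost, all motion plans found, i.e. the tree trajectories that end in $\varphi(\gamma(s,a))$, until one can be completed to a solution. In each RRT iteration a sample $x$ is drawn uniformly from $C$, the nearest tree vertex $v$ is steered straight towards $x$ by at most the step size $\eta>0$, and the new vertex and edge are added if the edge lies in the free set; the initial tree is the vertex $q$ if $q$ is in the free set, and empty otherwise. All samples, within one RRT call and across the calls, are independent. **Lemma (TMP-IDAN is probabilistically complete).** Suppose that there is a solution with clearance whose sequence of actions is contained in $\Gamma$ within some finite depth. Then $$\lim_{l,t\to\infty} P\big(\text{TMP-IDAN with depth limit } l \text{ and time } t \text{ returns a solution}\big)=1,$$ where $l$ and $t$ go to infinity jointly, and the (outer) probability that it does not return a solution tends to $0$. -/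

import Mathlib

open MeasureTheory ProbabilityTheory Filter Topology

noncomputable section

/-! ### The task-motion planning problem -/

/-- Configurations are vectors of `d` real coordinates. -/
abbrev Conf (d : ℕ) := EuclideanSpace ℝ (Fin d)

/-- A trajectory `τ : [0,1] → ℝᵈ`. -/
abbrev Traj (d : ℕ) := C(unitInterval, Conf d)

/-- A task domain: transition function, start state and goal states. -/
structure TaskDomain (S A : Type*) where
  γ : S → A → S
  s₀ : S
  goal : Set S

/-- A motion planning domain: configuration space `C`, collision test `f` (`f q` means that `q` is
free), start configuration and goal configurations. -/
structure MotionDomain (d : ℕ) where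
  C : Set (Conf d)
  f : Conf d → Prop
  q₀ : Conf d
  goal : Set (Conf d)

/-- The free configurations. -/
def MotionDomain.free {d : ℕ} (M : MotionDomain d) : Set (Conf d) := {q | q ∈ M.C ∧ M.f q}

/-- A task-motion domain: `φ s` is the set of configurations that realize the state `s`, and `ξ a`
is the set of configurations admissible during the action `a`: the motion plans for `a` are the
trajectories in `ξ a`. -/
structure TaskMotionDomain (S A : Type*) (d : ℕ) extends TaskDomain S A where
  C : Set (Conf d)
  f : Conf d → Prop
  φ : S → Set (Conf d)
  ξ : A → Set (Conf d)
  q₀ : Conf d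

/-- A task-motion plan: actions `a₀, …, aₙ` with trajectories `τ₀, …, τₙ`. -/
abbrev TMPlan (A : Type*) (d : ℕ) := List (A × Traj d)

namespace TaskMotionDomain

variable {S A : Type*} {d : ℕ}

/-- The free configurations. -/
def free (Ψ : TaskMotionDomain S A d) : Set (Conf d) := {q | q ∈ Ψ.C ∧ Ψ.f q}

/-- The state `sᵢ` reached from `s₀` by the first `i` actions of a plan. -/
def stateAt (Ψ : TaskMotionDomain S A d) (p : TMPlan A d) (i : ℕ) : S :=
  ((p.take i).map Prod.fst).foldl Ψ.γ Ψ.s₀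

/-- `p` solves the task-motion planning problem for `Ψ`. -/
structure IsSolution (Ψ : TaskMotionDomain S A d) (p : TMPlan A d) : Prop where
  ne_nil : p ≠ []
  goal : Ψ.stateAt p p.length ∈ Ψ.goal
  start : ∀ h : 0 < p.length, p[0].2 0 = Ψ.q₀
  source : ∀ (i : ℕ) (h : i < p.length), p[i].2 0 ∈ Ψ.φ (Ψ.stateAt p i)
  target : ∀ (i : ℕ) (h : i < p.length), p[i].2 1 ∈ Ψ.φ (Ψ.stateAt p (i + 1))
  glue : ∀ (i : ℕ) (h : i + 1 < p.length), p[i + 1].2 0 = p[i].2 1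
  free : ∀ (i : ℕ) (h : i < p.length) (u : unitInterval), p[i].2 u ∈ Ψ.free
  action : ∀ (i : ℕ) (h : i < p.length) (u : unitInterval), p[i].2 u ∈ Ψ.ξ p[i].1

/-- Clearance: for some `δ > 0`, all configurations of `C` at distance less than `δ` from `τᵢ` are
free and admissible for `aᵢ`, and all those at distance less than `δ` from the end point of `τᵢ`
realize the state `sᵢ₊₁`. -/
def HasClearance (Ψ : TaskMotionDomain S A d) (p : TMPlan A d) : Prop :=
  ∃ δ : ℝ, 0 < δ ∧ ∀ (i : ℕ) (h : i < p.length),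
    (∀ u : unitInterval, Metric.ball (p[i].2 u) δ ∩ Ψ.C ⊆ Ψ.free ∩ Ψ.ξ p[i].1) ∧
    Metric.ball (p[i].2 1) δ ∩ Ψ.C ⊆ Ψ.φ (Ψ.stateAt p (i + 1))

/-- The motion planning domain of the action `a`, taken in the state `s` at the configuration `q`. -/
def motionDomain (Ψ : TaskMotionDomain S A d) (s : S) (q : Conf d) (a : A) : MotionDomain d where
  C := Ψ.C
  f := fun x => Ψ.f x ∧ x ∈ Ψ.ξ a
  q₀ := q
  goal := Ψ.φ (Ψ.γ s a)

end TaskMotionDomain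

/-! ### AND/OR graph networks -/

/-- An AND/OR graph with nodes `N` and hyper-arcs `H`. -/
structure AndOrGraph (N H : Type*) where
  children : H → Finset N
  parent : H → N

/-- The augmented graph: `none` is the augmented node `nᵃ`, and `k : K` is an augmented hyper-arc
from `nᵃ` to the node `aug k`. -/
def AndOrGraph.augment {N H K : Type*} (G : AndOrGraph N H) (aug : K → N) :
    AndOrGraph (Option N) (H ⊕ K) where
  children := Sum.elim (fun h => (G.children h).map Function.Embedding.some) (fun _ => {none})
  parent := Sum.elim (fun h => some (G.parent h)) (fun k => some (aug k))

/-- An augmented AND/OR graph that models the task domain `D`: nodes carry symbolic descriptions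
(the sets of states that satisfy them), hyper-arcs carry sequences of actions and costs, and some
nodes without successors are labelled success or failure. A hyper-arc carries at least one action;
only an augmented hyper-arc that merely records a fact about the current configuration carries
none. -/
structure TaskGraph {S A : Type*} (D : TaskDomain S A) (N H K : Type*) where
  graph : AndOrGraph N H
  aug : K → N
  label : N → Set S
  acts : H ⊕ K → List A
  cost : H ⊕ K → ℝ
  success : Finset N
  failure : Finset N
  disjoint : Disjoint success failure
  success_terminal : ∀ n ∈ success, ∀ h, n ∉ graph.children h
  failure_terminal : ∀ n ∈ failure, ∀ h, n ∉ graph.children h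
  success_goal : ∀ n ∈ success, label n ⊆ D.goal
  acts_ne_nil : ∀ h : H, acts (Sum.inl h) ≠ []
  aug_acts_ne_nil : ∀ k : K, aug k ∈ success → acts (Sum.inr k) ≠ []

namespace TaskGraph

variable {S A : Type*} {D : TaskDomain S A} {N H K : Type*}

/-- The augmented AND/OR graph `Gᵃ`. -/
def augmented (G : TaskGraph D N H K) : AndOrGraph (Option N) (H ⊕ K) := G.graph.augment G.aug

/-- The states that satisfy a node of `Gᵃ`; the augmented node stands for the current
configuration, so it is always satisfied. -/
def sat (G : TaskGraph D N H K) (n : Option N) : Set S := n.elim Set.univ G.label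

/-- With the nodes `ach` achieved so far and the current state `s`, the hyper-arc `h` can be
traversed: all its children are achieved (AND), and its parent is not yet. -/
def Feasible (G : TaskGraph D N H K) (ach : Finset (Option N)) (s : S) (h : H ⊕ K) : Prop :=
  (∀ n ∈ G.augmented.children h, n ∈ ach ∧ s ∈ G.sat n) ∧ G.augmented.parent h ∉ ach

/-- The parent of `h` is a success node. -/
def IsSuccess (G : TaskGraph D N H K) (h : H ⊕ K) : Prop :=
  ∃ n ∈ G.success, G.augmented.parent h = some n

/-- The parent of `h` is a failure node. -/
def IsFailure (G : TaskGraph D N H K) (h : H ⊕ K) : Prop :=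
  ∃ n ∈ G.failure, G.augmented.parent h = some n

end TaskGraph

/-- An AND/OR graph network: the `i`-th graph is the one that is appended after `i` unsolved
graphs. -/
abbrev GraphNetwork {S A : Type*} (D : TaskDomain S A) (N H K : Type*) := ℕ → TaskGraph D N H K

/-- `Γ.SolvedBy i m ach s as`: starting in the `i`-th graph with achieved nodes `ach` and current
state `s`, the network is solved by the action sequence `as`, using at most `m` graphs counting the
`i`-th. A graph is left for the next one at a failure node, or if it is given up while it still has
a feasible hyper-arc; the next graph starts from the current state with only its augmented node
achieved. -/
inductive GraphNetwork.SolvedBy {S A : Type*} {D : TaskDomain S A} {N H K : Type*} [DecidableEq N]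
    (Γ : GraphNetwork D N H K) : ℕ → ℕ → Finset (Option N) → S → List A → Prop
  | success {i m : ℕ} {ach : Finset (Option N)} {s : S} (h : H ⊕ K) :
      (Γ i).Feasible ach s h → (Γ i).IsSuccess h →
      ((Γ i).acts h).foldl D.γ s ∈ (Γ i).sat ((Γ i).augmented.parent h) →
      SolvedBy Γ i (m + 1) ach s ((Γ i).acts h)
  | failure {i m : ℕ} {ach : Finset (Option N)} {s : S} {as : List A} (h : H ⊕ K) :
      (Γ i).Feasible ach s h → (Γ i).IsFailure h →
      ((Γ i).acts h).foldl D.γ s ∈ (Γ i).sat ((Γ i).augmented.parent h) →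
      SolvedBy Γ (i + 1) m {none} (((Γ i).acts h).foldl D.γ s) as →
      SolvedBy Γ i (m + 1) ach s ((Γ i).acts h ++ as)
  | step {i m : ℕ} {ach : Finset (Option N)} {s : S} {as : List A} (h : H ⊕ K) :
      (Γ i).Feasible ach s h → ¬ (Γ i).IsSuccess h → ¬ (Γ i).IsFailure h →
      ((Γ i).acts h).foldl D.γ s ∈ (Γ i).sat ((Γ i).augmented.parent h) →
      SolvedBy Γ i (m + 1) (insert ((Γ i).augmented.parent h) ach)
        (((Γ i).acts h).foldl D.γ s) as →
      SolvedBy Γ i (m + 1) ach s ((Γ i).acts h ++ as)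
  | retry {i m : ℕ} {ach : Finset (Option N)} {s : S} {as : List A} :
      (∃ h, (Γ i).Feasible ach s h) → SolvedBy Γ (i + 1) m {none} s as →
      SolvedBy Γ i (m + 1) ach s as

/-- The network, grown from its first graph in the start state, contains the task plan `as`
within depth `l`. -/
def GraphNetwork.ContainsPlan {S A : Type*} {D : TaskDomain S A} {N H K : Type*} [DecidableEq N]
    (Γ : GraphNetwork D N H K) (l : ℕ) (as : List A) : Prop :=
  Γ.SolvedBy 0 l {none} D.s₀ as

/-! ### The RRT motion planner -/

namespace RRT

variable {d : ℕ}

/-- A vertex of the tree, with the trajectory along the tree from the root `q` to it. -/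
structure Vertex (q : Conf d) where
  pt : Conf d
  path : Path q pt

/-- Move from `x` straight towards `y`, by at most the step size `η`. -/
def steer (η : ℝ) (x y : Conf d) : Conf d :=
  if dist x y ≤ η then y else x + (η / dist x y) • (y - x)

open Classical in
/-- One iteration: steer from the vertex nearest to the sample `x` towards `x`, and add the new
vertex and edge if the edge is free. -/
def extend (M : MotionDomain d) (η : ℝ) (T : List (Vertex M.q₀)) (x : Conf d) :
    List (Vertex M.q₀) :=
  match T.argmin (fun v => dist v.pt x) with
  | none => T
  | some v =>
    if segment ℝ v.pt (steer η v.pt x) ⊆ M.free then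
      T ++ [⟨steer η v.pt x, v.path.trans (Path.segment v.pt (steer η v.pt x))⟩]
    else T

open Classical in
/-- The tree after `t` iterations with the samples `x 0, …, x (t - 1)`. -/
def tree (M : MotionDomain d) (η : ℝ) (x : ℕ → Conf d) : ℕ → List (Vertex M.q₀)
  | 0 => if M.q₀ ∈ M.free then [⟨M.q₀, Path.refl M.q₀⟩] else []
  | t + 1 => extend M η (tree M η x t) (x t)

open Classical in
/-- The motion plans found in `t` iterations: the tree trajectories that end in a goal
configuration. -/
def plans (M : MotionDomain d) (η : ℝ) (x : ℕ → Conf d) (t : ℕ) : List (Traj d) :=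
  ((tree M η x t).filter (fun v => v.pt ∈ M.goal)).map (fun v => v.path.toContinuousMap)

end RRT

/-! ### TMP-IDAN -/

namespace TMPIDAN

variable {S A : Type*} {d : ℕ} {N H K : Type*}

/-- The list `L`, ordered by increasing cost, each element with its position. -/
def ranked {α : Type*} (cost : α → ℝ) (L : List α) : List (α × ℕ) :=
  (L.mergeSort (fun a b => decide (cost a ≤ cost b))).zipIdx

/-- Plan motions for a sequence of actions from the state `s` and the configuration `q`, then go on
with `cont`. Each action calls RRT for `t` iterations and tries the plans found, cheapest first, until
one can be completed. `w` records the choices made so far on the current branch of the search and so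
identifies the call: `X w n` is the `n`-th sample of the RRT call made at `w`. -/
def simulate (Ψ : TaskMotionDomain S A d) (mcost : Traj d → ℝ) (η : ℝ) (t : ℕ)
    (X : List ℕ → ℕ → Conf d) (cont : S → Conf d → List ℕ → Option (TMPlan A d)) :
    List A → S → Conf d → List ℕ → Option (TMPlan A d)
  | [], s, q, w => cont s q w
  | a :: as, s, q, w =>
    (ranked mcost (RRT.plans (Ψ.motionDomain s q a) η (X w) t)).findSome? fun τj =>
      (simulate Ψ mcost η t X cont as (Ψ.γ s a) (τj.1 1) (τj.2 :: w)).map ((a, τj.1) :: ·)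

open Classical in
/-- Search one graph `G`, given the nodes achieved so far: if there is no feasible hyper-arc, give
up; otherwise try the feasible hyper-arcs, cheapest first, and if none of them leads to a solution,
pass the current state and configuration to `next`, the search from the next graph of the network.
The number `k` bounds the number of further nodes of `G` that can be achieved. -/
def searchGraph [DecidableEq N] [Fintype H] [Fintype K] (Ψ : TaskMotionDomain S A d) (mcost : Traj d → ℝ) (η : ℝ)
    (t : ℕ) (X : List ℕ → ℕ → Conf d) (G : TaskGraph Ψ.toTaskDomain N H K)
    (next : S → Conf d → List ℕ → Option (TMPlan A d)) :
    ℕ → Finset (Option N) → S → Conf d → List ℕ → Option (TMPlan A d)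
  | 0, _, _, _, _ => none
  | k + 1, ach, s, q, w =>
    if ∃ h, G.Feasible ach s h then
      ((ranked G.cost (Finset.univ.filter (fun h => G.Feasible ach s h)).toList).findSome? fun hj =>
        simulate Ψ mcost η t X
          (fun s' q' w' =>
            if s' ∈ G.sat (G.augmented.parent hj.1) then
              if G.IsSuccess hj.1 then some []
              else if G.IsFailure hj.1 then next s' q' w'
              else searchGraph Ψ mcost η t X G next k (insert (G.augmented.parent hj.1) ach) s' q' w'
            else none)
          (G.acts hj.1) s q ((hj.2 + 1) :: w)).or
        (next s q (0 :: w))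
    else none

/-- Search the network from its `i`-th graph on, with `l` more graphs allowed. -/
def searchNetwork [Fintype N] [DecidableEq N] [Fintype H] [Fintype K] (Ψ : TaskMotionDomain S A d)
    (mcost : Traj d → ℝ) (η : ℝ) (t : ℕ) (X : List ℕ → ℕ → Conf d)
    (Γ : GraphNetwork Ψ.toTaskDomain N H K) :
    ℕ → ℕ → S → Conf d → List ℕ → Option (TMPlan A d)
  | 0, _ => fun _ _ _ => none
  | l + 1, i => searchGraph Ψ mcost η t X (Γ i)
      (searchNetwork Ψ mcost η t X Γ l (i + 1)) (Fintype.card N) {none}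

/-- TMP-IDAN with depth limit `l` and `t` iterations for each call of RRT, run with the samples `X`:
the plan it returns, if any. -/
def run [Fintype N] [DecidableEq N] [Fintype H] [Fintype K] (Ψ : TaskMotionDomain S A d)
    (Γ : GraphNetwork Ψ.toTaskDomain N H K) (mcost : Traj d → ℝ) (η : ℝ)
    (X : List ℕ → ℕ → Conf d) (l t : ℕ) : Option (TMPlan A d) :=
  searchNetwork Ψ mcost η t X Γ l 0 Ψ.s₀ Ψ.q₀ []

/-- The run returns a solution of the task-motion planning problem. -/
def Finds [Fintype N] [DecidableEq N] [Fintype H] [Fintype K] (Ψ : TaskMotionDomain S A d)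
    (Γ : GraphNetwork Ψ.toTaskDomain N H K) (mcost : Traj d → ℝ) (η : ℝ)
    (X : List ℕ → ℕ → Conf d) (l t : ℕ) : Prop :=
  ∃ p, run Ψ Γ mcost η X l t = some p ∧ Ψ.IsSolution p

end TMPIDAN

end

/-!
**Soundness.** RRT trajectories are free and end in the goal of their call, and an action sequence
is accepted only at a success node, so every plan that is returned is a solution.

**Completeness.** Cut each trajectory of the solution with clearance into `m` pieces so short that
a sample near a way point is within reach of a tree vertex near the previous one, by a free edge.
Then RRT follows the trajectory as soon as its samples, cut into `m` blocks of `t / m`, hit the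
neighborhoods of the way points one after the other; by independence within the call this fails
with probability `O(ρ ^ (t / m))` for some `ρ < 1`. If every call on which the search depends has
such samples, the search succeeds, at the latest on the branch that follows the solution. A call is
identified by the choices made before it. Following the solution takes a number of choices that
does not depend on `t`, and each choice has `t + O(1)` alternatives, so the union bound runs over
polynomially many calls in `t` and the probability of failure tends to `0`.
-/

/-! ### Measures -/

theorem tendsto_measure_one_of_tendsto_measure_compl_zero {Ω ι : Type*} [MeasurableSpace Ω]
    {P : Measure Ω} [IsProbabilityMeasure P] {l : Filter ι} {s : ι → Set Ω}
    (h : Tendsto (fun i => P (s i)ᶜ) l (𝓝 0)) : Tendsto (fun i => P (s i)) l (𝓝 1) := by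
  have hsub : Tendsto (fun i => 1 - P (s i)ᶜ) l (𝓝 1) := by
    simpa using ENNReal.Tendsto.sub tendsto_const_nhds h (Or.inl ENNReal.one_ne_top)
  refine tendsto_of_tendsto_of_tendsto_of_le_of_le hsub tendsto_const_nhds (fun i => ?_)
    fun i => prob_le_one
  exact tsub_le_iff_right.2 (measure_univ (μ := P) ▸ measure_univ_le_add_compl (s i))

theorem subset_support_cond_of_convex {E : Type*} [NormedAddCommGroup E] [NormedSpace ℝ E]
    [MeasurableSpace E] [OpensMeasurableSpace E] {μ : Measure E} [μ.IsOpenPosMeasure] {C : Set E}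
    (hconv : Convex ℝ C) (hint : (interior C).Nonempty) (hμ : μ C ≠ ⊤) : C ⊆ (μ[|C]).support := by
  intro c hc
  refine Metric.nhds_basis_ball.mem_measureSupport.2 fun r hr => ?_
  have hcl : c ∈ closure (interior C) :=
    hconv.closure_interior_eq_closure_of_nonempty_interior hint ▸ subset_closure hc
  have hne : (Metric.ball c r ∩ interior C).Nonempty :=
    mem_closure_iff.1 hcl _ Metric.isOpen_ball (Metric.mem_ball_self hr)
  rw [cond_apply' measurableSet_ball, Set.inter_comm C]
  refine ENNReal.mul_pos (ENNReal.inv_ne_zero.2 hμ) ?_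
  refine (((Metric.isOpen_ball.inter isOpen_interior).measure_pos μ hne).trans_le ?_).ne'
  gcongr
  exact interior_subset

theorem exists_lt_one_measure_compl_ball_le {E : Type*} [PseudoMetricSpace E] [MeasurableSpace E]
    [OpensMeasurableSpace E] {ν : Measure E} [IsProbabilityMeasure ν] {K : Set E}
    (hK : IsCompact K) (hsupp : K ⊆ ν.support) {r : ℝ} (hr : 0 < r) :
    ∃ ρ < (1 : ENNReal), ∀ c ∈ K, ν (Metric.ball c r)ᶜ ≤ ρ := by
  obtain ⟨F, hFK, hcover⟩ := hK.elim_nhds_subcover (fun c => Metric.ball c (r / 2))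
    fun c _ => Metric.ball_mem_nhds c (half_pos hr)
  refine ⟨F.sup fun c => ν (Metric.ball c (r / 2))ᶜ, ?_, fun c hc => ?_⟩
  · refine (Finset.sup_lt_iff one_pos).2 fun c hc => ?_
    rw [prob_compl_eq_one_sub measurableSet_ball]
    exact ENNReal.sub_lt_self ENNReal.one_ne_top one_ne_zero
      (Metric.nhds_basis_ball.mem_measureSupport.1 (hsupp (hFK c hc)) _ (half_pos hr)).ne'
  · obtain ⟨e, he, hce⟩ := Set.mem_iUnion₂.1 (hcover hc)
    have hball : Metric.ball e (r / 2) ⊆ Metric.ball c r := by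
      refine Metric.ball_subset_ball' ?_
      rw [dist_comm]
      linarith [Metric.mem_ball.1 hce]
    exact (measure_mono (Set.compl_subset_compl.2 hball)).trans
      (Finset.le_sup (f := fun c => ν (Metric.ball c (r / 2))ᶜ) he)

theorem tendsto_natCast_pow_mul_pow_zero {ρ : ENNReal} (hρ : ρ < 1) (n : ℕ) :
    Tendsto (fun s : ℕ => (s : ENNReal) ^ n * ρ ^ s) atTop (𝓝 0) := by
  lift ρ to NNReal using (hρ.trans ENNReal.one_lt_top).ne
  have hreal : Tendsto (fun s : ℕ => (((s : NNReal) ^ n * ρ ^ s : NNReal) : ℝ)) atTop (𝓝 0) := by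
    push_cast
    exact tendsto_pow_const_mul_const_pow_of_lt_one n ρ.coe_nonneg (by exact_mod_cast hρ)
  have hnn : Tendsto (fun s : ℕ => (s : NNReal) ^ n * ρ ^ s) atTop (𝓝 0) :=
    NNReal.tendsto_coe.1 hreal
  simpa only [ENNReal.coe_mul, ENNReal.coe_pow, ENNReal.coe_natCast, ENNReal.coe_zero] using
    ENNReal.tendsto_coe.2 hnn

theorem tendsto_natCast_add_pow_mul_pow_div_zero {ρ : ENNReal} (hρ : ρ < 1) (n b : ℕ) {m : ℕ}
    (hm : 0 < m) :
    Tendsto (fun t : ℕ => ((t + b : ℕ) : ENNReal) ^ n * ρ ^ (t / m)) atTop (𝓝 0) := by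
  have hlim : Tendsto (fun s : ℕ => ((2 * m + b : ℕ) : ENNReal) ^ n * ((s : ENNReal) ^ n * ρ ^ s))
      atTop (𝓝 0) := by
    simpa using ENNReal.Tendsto.const_mul (tendsto_natCast_pow_mul_pow_zero hρ n)
      (Or.inr (by finiteness))
  refine tendsto_of_tendsto_of_tendsto_of_le_of_le' tendsto_const_nhds
    (hlim.comp (Nat.tendsto_div_const_atTop hm.ne')) (Eventually.of_forall fun _ => zero_le) ?_
  filter_upwards [eventually_ge_atTop m] with t ht
  have hle : t + b ≤ (2 * m + b) * (t / m) := by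
    have hdiv : 1 ≤ t / m := (Nat.one_le_div_iff hm).2 ht
    have hlt : t < m * (t / m) + m := Nat.lt_mul_div_succ t hm
    nlinarith
  rw [Function.comp_apply, ← mul_assoc, ← mul_pow]
  gcongr
  exact_mod_cast hle

/-! ### RRT -/

namespace RRT

section Soundness

variable {d : ℕ} {M : MotionDomain d} {η : ℝ} {x : ℕ → Conf d} {t : ℕ}

theorem mem_extend {T : List (Vertex M.q₀)} {y : Conf d} {v : Vertex M.q₀}
    (hv : v ∈ extend M η T y) :
    v ∈ T ∨ ∃ u ∈ T, segment ℝ u.pt (steer η u.pt y) ⊆ M.free ∧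
      v = ⟨steer η u.pt y, u.path.trans (Path.segment u.pt (steer η u.pt y))⟩ := by
  unfold extend at hv
  split at hv
  · exact Or.inl hv
  · rename_i u hu
    split_ifs at hv with hseg
    · exact (List.mem_append.1 hv).imp_right fun hv =>
        ⟨u, List.argmin_mem hu, hseg, List.mem_singleton.1 hv⟩
    · exact Or.inl hv

theorem path_mem_free {v : Vertex M.q₀} (hv : v ∈ tree M η x t) (u : unitInterval) :
    v.path u ∈ M.free := by
  induction t generalizing v u with
  | zero =>
    unfold tree at hv
    split_ifs at hv with hq₀
    · obtain rfl := List.mem_singleton.1 hv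
      exact hq₀
    · exact absurd hv List.not_mem_nil
  | succ t ih =>
    rcases mem_extend hv with hv | ⟨v', hv', hseg, rfl⟩
    · exact ih hv u
    · have hu : (v'.path.trans (Path.segment v'.pt (steer η v'.pt (x t)))) u ∈
          Set.range v'.path ∪ segment ℝ v'.pt (steer η v'.pt (x t)) := by
        rw [← Path.range_segment, ← Path.trans_range]
        exact Set.mem_range_self u
      rcases hu with ⟨u', hu'⟩ | hu
      · exact hu' ▸ ih hv' u'
      · exact hseg hu

theorem pt_mem_free {v : Vertex M.q₀} (hv : v ∈ tree M η x t) : v.pt ∈ M.free := by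
  simpa only [Path.target] using path_mem_free hv 1

theorem plans_sound {τ : Traj d} (hτ : τ ∈ plans M η x t) :
    τ 0 = M.q₀ ∧ τ 1 ∈ M.goal ∧ ∀ u, τ u ∈ M.free := by
  obtain ⟨v, hv, rfl⟩ := List.mem_map.1 hτ
  obtain ⟨hv, hgoal⟩ := List.mem_filter.1 hv
  simp only [decide_eq_true_eq] at hgoal
  have htarget : v.path.toContinuousMap 1 = v.pt := v.path.target
  exact ⟨v.path.source, by rwa [htarget], path_mem_free hv⟩

theorem exists_mem_plans {v : Vertex M.q₀} (hv : v ∈ tree M η x t) (hgoal : v.pt ∈ M.goal) :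
    ∃ τ ∈ plans M η x t, τ 1 = v.pt :=
  ⟨v.path.toContinuousMap,
    List.mem_map_of_mem (List.mem_filter.2 ⟨hv, by simpa only [decide_eq_true_eq]⟩), v.path.target⟩

end Soundness

section Growth

variable {d : ℕ} (M : MotionDomain d) (η : ℝ)

theorem subset_extend (T : List (Vertex M.q₀)) (y : Conf d) : T ⊆ extend M η T y := by
  unfold extend
  split
  · exact List.Subset.refl _
  · split_ifs
    · exact List.subset_append_left _ _
    · exact List.Subset.refl _

theorem length_extend_le (T : List (Vertex M.q₀)) (y : Conf d) :
    (extend M η T y).length ≤ T.length + 1 := by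
  unfold extend
  split
  · exact Nat.le_succ _
  · split_ifs
    · simp only [List.length_append, List.length_singleton, le_refl]
    · exact Nat.le_succ _

theorem tree_subset_tree (x : ℕ → Conf d) {t t' : ℕ} (h : t ≤ t') :
    tree M η x t ⊆ tree M η x t' := by
  induction h with
  | refl => exact List.Subset.refl _
  | step _ ih => exact List.Subset.trans ih (subset_extend _ _ _ _)

theorem length_tree_le (x : ℕ → Conf d) (t : ℕ) : (tree M η x t).length ≤ t + 1 := by
  induction t with
  | zero => unfold tree; split_ifs <;> simp
  | succ t ih => exact (length_extend_le _ _ _ _).trans (Nat.succ_le_succ ih)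

theorem length_plans_le (x : ℕ → Conf d) (t : ℕ) : (plans M η x t).length ≤ t + 1 :=
  (List.length_map _).trans_le ((List.length_filter_le _ _).trans (length_tree_le M η x t))

end Growth

section Reachability

variable {d : ℕ} {M : MotionDomain d} {η r : ℝ}

theorem steer_of_dist_le {y z : Conf d} (h : dist y z ≤ η) : steer η y z = z := if_pos h

theorem exists_mem_extend (hC : Convex ℝ M.C) (hrη : r ≤ η) {T : List (Vertex M.q₀)}
    (hT : ∀ u ∈ T, u.pt ∈ M.C) {v : Vertex M.q₀} (hv : v ∈ T) {y : Conf d} (hy : y ∈ M.C)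
    (hvy : dist v.pt y ≤ r) (hfree : Metric.closedBall y r ∩ M.C ⊆ M.free) :
    ∃ u ∈ extend M η T y, u.pt = y := by
  obtain ⟨u, hu⟩ : ∃ u, T.argmin (fun u => dist u.pt y) = some u :=
    Option.ne_none_iff_exists'.1 fun h =>
      List.ne_nil_of_mem hv (List.argmin_eq_none.1 h)
  have huy : dist u.pt y ≤ r :=
    (List.le_of_mem_argmin (f := fun v : Vertex M.q₀ => dist v.pt y) hv hu).trans hvy
  have hsteer : steer η u.pt y = y := steer_of_dist_le (huy.trans hrη)
  have hseg : segment ℝ u.pt (steer η u.pt y) ⊆ M.free := by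
    rw [hsteer]
    refine (Set.subset_inter ?_ (hC.segment_subset (hT u (List.argmin_mem hu)) hy)).trans hfree
    exact (convex_closedBall y r).segment_subset (Metric.mem_closedBall.2 huy)
      (Metric.mem_closedBall_self (dist_nonneg.trans huy))
  simp only [extend, hu, if_pos hseg]
  exact ⟨_, List.mem_append_right _ List.mem_cons_self, hsteer⟩

/-- The points `x 0, …, x (m * s - 1)`, cut into `m` blocks of length `s`, visit the sets
`U 0, …, U (m - 1)` one after the other: some point of the `k`-th block lies in `U k`. -/
def Visits {E : Type*} (U : ℕ → Set E) (m s : ℕ) (x : ℕ → E) : Prop :=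
  ∀ k < m, ∃ i ∈ Finset.Ico (k * s) ((k + 1) * s), x i ∈ U k

theorem exists_mem_tree_of_visits (hC : Convex ℝ M.C) (hrη : 3 * r ≤ η) {δ : ℝ}
    (hrδ : 4 * r < δ) {c : ℕ → Conf d} {m s : ℕ} (hc : ∀ k < m, dist (c k) (c (k + 1)) ≤ r)
    (hfree : ∀ k ≤ m, Metric.ball (c k) δ ∩ M.C ⊆ M.free) (hq : M.q₀ ∈ M.C)
    (hq₀ : dist M.q₀ (c 0) < r) {x : ℕ → Conf d} (hxC : ∀ i, x i ∈ M.C)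
    (hx : Visits (fun k => Metric.ball (c (k + 1)) r) m s x) :
    ∃ v ∈ tree M η x (m * s), dist v.pt (c m) < r := by
  suffices h : ∀ k ≤ m, ∃ v ∈ tree M η x (k * s), dist v.pt (c k) < r from h m le_rfl
  intro k hk
  induction k with
  | zero =>
    have hr : 0 < r := dist_nonneg.trans_lt hq₀
    have hq₀free : M.q₀ ∈ M.free := hfree 0 hk ⟨Metric.mem_ball.2 (by linarith), hq⟩
    refine ⟨⟨M.q₀, Path.refl M.q₀⟩, ?_, hq₀⟩
    simp only [Nat.zero_mul, tree, if_pos hq₀free, List.mem_singleton]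
  | succ k ih =>
    obtain ⟨v, hv, hvk⟩ := ih (Nat.le_of_succ_le hk)
    obtain ⟨i, hi, hxi⟩ := hx k hk
    rw [Finset.mem_Ico] at hi
    rw [Metric.mem_ball] at hxi
    have hvx : dist v.pt (x i) ≤ 3 * r := by
      have htri := dist_triangle4_right v.pt (x i) (c k) (c (k + 1))
      linarith [hc k hk]
    have hball : Metric.closedBall (x i) (3 * r) ⊆ Metric.ball (c (k + 1)) δ :=
      Metric.closedBall_subset_ball' (by linarith)
    obtain ⟨u, hu, hux⟩ := exists_mem_extend hC hrη (fun u hu => (pt_mem_free hu).1)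
      (tree_subset_tree M η x hi.1 hv) (hxC i) hvx
      ((Set.inter_subset_inter_left _ hball).trans (hfree (k + 1) hk))
    exact ⟨u, tree_subset_tree M η x (t := i + 1) hi.2 hu, hux ▸ hxi⟩

end Reachability

end RRT

/-! ### Soundness of the search -/

namespace TaskMotionDomain

variable {S A : Type*} {d : ℕ} {Ψ : TaskMotionDomain S A d}

/-- The domain `Ψ` with its start moved to the state `s` and the configuration `q`. -/
def startAt (Ψ : TaskMotionDomain S A d) (s : S) (q : Conf d) : TaskMotionDomain S A d :=
  { Ψ with s₀ := s, q₀ := q }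

/-- `Ψ.IsCompletion s q p`: from the state `s` and the configuration `q`, the plan `p` leads to a
goal state. Unlike a solution, `p` may be empty, and `q` need not realize `s`. -/
def IsCompletion (Ψ : TaskMotionDomain S A d) : S → Conf d → TMPlan A d → Prop
  | s, _, [] => s ∈ Ψ.goal
  | s, q, (a, τ) :: p => τ 0 = q ∧ (∀ u, τ u ∈ Ψ.free ∩ Ψ.ξ a) ∧ τ 1 ∈ Ψ.φ (Ψ.γ s a) ∧
      IsCompletion Ψ (Ψ.γ s a) (τ 1) p

theorem IsSolution.mem_C {p : TMPlan A d} (hp : Ψ.IsSolution p) {aτ : A × Traj d} (h : aτ ∈ p)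
    (u : unitInterval) : aτ.2 u ∈ Ψ.C := by
  obtain ⟨i, hi, rfl⟩ := List.mem_iff_getElem.1 h
  exact (hp.free i hi u).1

theorem IsSolution.cons {a : A} {τ : Traj d} {p : TMPlan A d} (hq₀ : Ψ.q₀ ∈ Ψ.φ Ψ.s₀)
    (h0 : τ 0 = Ψ.q₀) (hfree : ∀ u, τ u ∈ Ψ.free ∩ Ψ.ξ a) (h1 : τ 1 ∈ Ψ.φ (Ψ.γ Ψ.s₀ a))
    (hnil : p = [] → Ψ.γ Ψ.s₀ a ∈ Ψ.goal)
    (hcons : p ≠ [] → (Ψ.startAt (Ψ.γ Ψ.s₀ a) (τ 1)).IsSolution p) :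
    Ψ.IsSolution ((a, τ) :: p) := by
  have htail {i : ℕ} (hi : i + 1 < p.length + 1) :
      (Ψ.startAt (Ψ.γ Ψ.s₀ a) (τ 1)).IsSolution p ∧ i < p.length :=
    have hi := Nat.lt_of_succ_lt_succ hi
    ⟨hcons (List.ne_nil_of_length_pos (Nat.zero_lt_of_lt hi)), hi⟩
  refine ⟨List.cons_ne_nil _ _, ?_, fun _ => h0, ?_, ?_, ?_, ?_, ?_⟩
  · rcases eq_or_ne p [] with hp | hp
    · subst hp
      exact hnil rfl
    · exact (hcons hp).goal
  · rintro (_ | i) hi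
    · exact (h0 ▸ hq₀ : τ 0 ∈ Ψ.φ Ψ.s₀)
    · exact (htail hi).1.source i (htail hi).2
  · rintro (_ | i) hi
    · exact h1
    · exact (htail hi).1.target i (htail hi).2
  · rintro (_ | i) hi
    · exact (htail hi).1.start (htail hi).2
    · exact (htail hi).1.glue i (htail hi).2
  · rintro (_ | i) hi u
    · exact (hfree u).1
    · exact (htail hi).1.free i (htail hi).2 u
  · rintro (_ | i) hi u
    · exact (hfree u).2
    · exact (htail hi).1.action i (htail hi).2 u

theorem IsCompletion.isSolution_startAt {p : TMPlan A d} (hp : p ≠ []) {s : S} {q : Conf d}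
    (hq : q ∈ Ψ.φ s) (h : Ψ.IsCompletion s q p) : (Ψ.startAt s q).IsSolution p := by
  induction p generalizing s q with
  | nil => exact absurd rfl hp
  | cons aτ p ih =>
    obtain ⟨h0, hfree, h1, hrest⟩ := h
    refine IsSolution.cons hq h0 hfree h1 ?_ fun hp => ih hp h1 hrest
    rintro rfl
    exact hrest

/-- The configurations of `C` at distance less than `δ` from the trajectories of `p` are free and
admissible, and those near the end points realize the next state: `HasClearance` for a given
clearance `δ`. -/
def IsClear (Ψ : TaskMotionDomain S A d) (δ : ℝ) (p : TMPlan A d) : Prop :=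
  ∀ (i : ℕ) (h : i < p.length),
    (∀ u : unitInterval, Metric.ball (p[i].2 u) δ ∩ Ψ.C ⊆ Ψ.free ∩ Ψ.ξ p[i].1) ∧
    Metric.ball (p[i].2 1) δ ∩ Ψ.C ⊆ Ψ.φ (Ψ.stateAt p (i + 1))

end TaskMotionDomain

namespace TaskGraph

variable {S A : Type*} {D : TaskDomain S A} {N H K : Type*} {G : TaskGraph D N H K} {h : H ⊕ K}

theorem acts_ne_nil_of_isSuccess (hs : G.IsSuccess h) : G.acts h ≠ [] := by
  obtain ⟨n, hn, hp⟩ := hs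
  rcases h with h | k
  · exact G.acts_ne_nil h
  · have hk : G.aug k = n := Option.some.inj hp
    exact G.aug_acts_ne_nil k (hk ▸ hn)

theorem mem_goal_of_isSuccess (hs : G.IsSuccess h) {s : S}
    (hsat : s ∈ G.sat (G.augmented.parent h)) : s ∈ D.goal := by
  obtain ⟨n, hn, hp⟩ := hs
  rw [hp] at hsat
  exact G.success_goal n hn hsat

theorem not_isSuccess_of_isFailure (hf : G.IsFailure h) : ¬ G.IsSuccess h := by
  rintro ⟨n, hn, hp⟩
  obtain ⟨n', hn', hp'⟩ := hf
  obtain rfl : n = n' := Option.some.inj (hp.symm.trans hp')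
  exact Finset.disjoint_left.1 G.disjoint hn hn'

theorem Feasible.exists_eq_succ [Fintype N] {ach : Finset (Option N)} {s : S}
    (hf : G.Feasible ach s h) {k : ℕ} (hk : Fintype.card N + 1 = k + ach.card) :
    ∃ k', k = k' + 1 := by
  have hlt : ach.card < Fintype.card (Option N) := Finset.card_lt_univ_of_notMem hf.2
  rw [Fintype.card_option] at hlt
  exact Nat.exists_eq_add_of_le' (by omega)

end TaskGraph

theorem GraphNetwork.SolvedBy.pos {S A : Type*} {D : TaskDomain S A} {N H K : Type*} [DecidableEq N]
    {Γ : GraphNetwork D N H K} {i m : ℕ} {ach : Finset (Option N)} {s : S} {as : List A}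
    (h : Γ.SolvedBy i m ach s as) : 0 < m := by
  cases h <;> exact Nat.succ_pos _

namespace TMPIDAN

theorem mem_of_mem_ranked {α : Type*} {cost : α → ℝ} {L : List α} {x : α × ℕ}
    (hx : x ∈ ranked cost L) : x.1 ∈ L :=
  List.mem_mergeSort.1 (List.fst_mem_of_mem_zipIdx hx)

theorem exists_mem_ranked {α : Type*} (cost : α → ℝ) {L : List α} {x : α} (hx : x ∈ L) :
    ∃ j < L.length, (x, j) ∈ ranked cost L := by
  obtain ⟨j, hj, rfl⟩ := List.mem_iff_getElem.1
    (List.mem_mergeSort (le := fun a b => decide (cost a ≤ cost b)).2 hx)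
  exact ⟨j, (List.length_mergeSort L).subst hj,
    List.mk_mem_zipIdx_iff_getElem?.2 (List.getElem?_eq_getElem hj)⟩

section Soundness

variable {S A : Type*} {d : ℕ} {N H K : Type*} {Ψ : TaskMotionDomain S A d}
  {mcost : Traj d → ℝ} {η : ℝ} {t : ℕ} {X : List ℕ → ℕ → Conf d}

theorem simulate_isCompletion {cont : S → Conf d → List ℕ → Option (TMPlan A d)} {as : List A}
    {s : S} {q : Conf d} {w : List ℕ} {p : TMPlan A d}
    (hcont : ∀ q' w' p', cont (as.foldl Ψ.γ s) q' w' = some p' →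
      Ψ.IsCompletion (as.foldl Ψ.γ s) q' p')
    (hp : simulate Ψ mcost η t X cont as s q w = some p) : Ψ.IsCompletion s q p := by
  induction as generalizing s q w p with
  | nil => exact hcont q w p hp
  | cons a as ih =>
    obtain ⟨τj, hτj, hp⟩ := List.exists_of_findSome?_eq_some hp
    obtain ⟨p', hp', rfl⟩ := Option.map_eq_some_iff.1 hp
    obtain ⟨h0, h1, hfree⟩ := RRT.plans_sound (mem_of_mem_ranked hτj)
    exact ⟨h0, fun u => ⟨⟨(hfree u).1, (hfree u).2.1⟩, (hfree u).2.2⟩, h1, ih hcont hp'⟩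

theorem simulate_eq_some_nil {cont : S → Conf d → List ℕ → Option (TMPlan A d)} {as : List A}
    {s : S} {q : Conf d} {w : List ℕ} (hp : simulate Ψ mcost η t X cont as s q w = some []) :
    as = [] ∧ cont s q w = some [] := by
  cases as with
  | nil => exact ⟨rfl, hp⟩
  | cons a as =>
    obtain ⟨τj, -, hp⟩ := List.exists_of_findSome?_eq_some hp
    obtain ⟨p, -, hp⟩ := Option.map_eq_some_iff.1 hp
    exact absurd hp (List.cons_ne_nil _ _)

/-- The part of `searchGraph` that follows the hyper-arc `h`, once its actions have led to the
state `s` and the configuration `q`: `recur` continues in the same graph with the parent of `h`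
achieved, and `next` continues in the next graph. -/
noncomputable def afterArc [DecidableEq N] (G : TaskGraph Ψ.toTaskDomain N H K)
    (next : S → Conf d → List ℕ → Option (TMPlan A d))
    (recur : Finset (Option N) → S → Conf d → List ℕ → Option (TMPlan A d))
    (ach : Finset (Option N)) (h : H ⊕ K) (s : S) (q : Conf d) (w : List ℕ) :
    Option (TMPlan A d) :=
  open Classical in
  if s ∈ G.sat (G.augmented.parent h) then
    if G.IsSuccess h then some []
    else if G.IsFailure h then next s q w
    else recur (insert (G.augmented.parent h) ach) s q w
  else none

section AfterArc

variable [DecidableEq N] {G : TaskGraph Ψ.toTaskDomain N H K}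
  {next : S → Conf d → List ℕ → Option (TMPlan A d)}
  {recur : Finset (Option N) → S → Conf d → List ℕ → Option (TMPlan A d)}
  {ach : Finset (Option N)} {h : H ⊕ K} {s : S}

theorem afterArc_of_isSuccess (hsat : s ∈ G.sat (G.augmented.parent h)) (hsucc : G.IsSuccess h) :
    afterArc G next recur ach h s = fun _ _ => some [] := by
  funext q w
  rw [afterArc, if_pos hsat, if_pos hsucc]

theorem afterArc_of_isFailure (hsat : s ∈ G.sat (G.augmented.parent h)) (hfail : G.IsFailure h) :
    afterArc G next recur ach h s = next s := by
  funext q w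
  rw [afterArc, if_pos hsat, if_neg (G.not_isSuccess_of_isFailure hfail), if_pos hfail]

theorem afterArc_of_not (hsat : s ∈ G.sat (G.augmented.parent h)) (hsucc : ¬ G.IsSuccess h)
    (hfail : ¬ G.IsFailure h) :
    afterArc G next recur ach h s = recur (insert (G.augmented.parent h) ach) s := by
  funext q w
  rw [afterArc, if_pos hsat, if_neg hsucc, if_neg hfail]

end AfterArc

open Classical in
theorem searchGraph_succ_of_feasible [DecidableEq N] [Fintype H] [Fintype K]
    {G : TaskGraph Ψ.toTaskDomain N H K} {next : S → Conf d → List ℕ → Option (TMPlan A d)}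
    {k : ℕ} {ach : Finset (Option N)} {s : S} (hex : ∃ h, G.Feasible ach s h) (q : Conf d)
    (w : List ℕ) :
    searchGraph Ψ mcost η t X G next (k + 1) ach s q w =
      ((ranked G.cost (Finset.univ.filter fun h => G.Feasible ach s h).toList).findSome? fun hj =>
        simulate Ψ mcost η t X
          (afterArc G next (searchGraph Ψ mcost η t X G next k) ach hj.1)
          (G.acts hj.1) s q ((hj.2 + 1) :: w)).or (next s q (0 :: w)) :=
  if_pos hex

/-- Every plan that the search `F` returns is a nonempty completion of the state and the
configuration at which the search was called. -/
def IsSound (Ψ : TaskMotionDomain S A d) (F : S → Conf d → List ℕ → Option (TMPlan A d)) : Prop :=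
  ∀ ⦃s q w p⦄, F s q w = some p → Ψ.IsCompletion s q p ∧ p ≠ []

theorem afterArc_isCompletion [DecidableEq N] {G : TaskGraph Ψ.toTaskDomain N H K}
    {next : S → Conf d → List ℕ → Option (TMPlan A d)}
    {recur : Finset (Option N) → S → Conf d → List ℕ → Option (TMPlan A d)}
    (hnext : IsSound Ψ next) (hrecur : ∀ ach, IsSound Ψ (recur ach)) {ach : Finset (Option N)}
    {h : H ⊕ K} {s : S} {q : Conf d} {w : List ℕ} {p : TMPlan A d}
    (hp : afterArc G next recur ach h s q w = some p) :
    Ψ.IsCompletion s q p ∧ (p = [] → G.IsSuccess h) := by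
  unfold afterArc at hp
  split_ifs at hp with hsat hsucc hfail
  · obtain rfl := Option.some.inj hp
    exact ⟨G.mem_goal_of_isSuccess hsucc hsat, fun _ => hsucc⟩
  · exact (hnext hp).imp_right fun hne hnil => absurd hnil hne
  · exact (hrecur _ hp).imp_right fun hne hnil => absurd hnil hne

theorem isSound_searchGraph [DecidableEq N] [Fintype H] [Fintype K]
    {G : TaskGraph Ψ.toTaskDomain N H K} {next : S → Conf d → List ℕ → Option (TMPlan A d)}
    (hnext : IsSound Ψ next) (k : ℕ) (ach : Finset (Option N)) :
    IsSound Ψ (searchGraph Ψ mcost η t X G next k ach) := by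
  induction k generalizing ach with
  | zero => exact fun _ _ _ _ hp => absurd hp.symm (Option.some_ne_none _)
  | succ k ih =>
    intro s q w p hp
    by_cases hex : ∃ h, G.Feasible ach s h
    · rw [searchGraph_succ_of_feasible hex] at hp
      rcases Option.or_eq_some_iff.1 hp with hp | ⟨-, hp⟩
      · obtain ⟨hj, -, hp⟩ := List.exists_of_findSome?_eq_some hp
        refine ⟨simulate_isCompletion (fun _ _ _ h => (afterArc_isCompletion hnext ih h).1) hp, ?_⟩
        rintro rfl
        obtain ⟨hacts, hnil⟩ := simulate_eq_some_nil hp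
        exact G.acts_ne_nil_of_isSuccess ((afterArc_isCompletion hnext ih hnil).2 rfl) hacts
      · exact hnext hp
    · rw [searchGraph, if_neg hex] at hp
      exact absurd hp.symm (Option.some_ne_none _)

theorem isSound_searchNetwork [Fintype N] [DecidableEq N] [Fintype H] [Fintype K]
    {Γ : GraphNetwork Ψ.toTaskDomain N H K} (l i : ℕ) :
    IsSound Ψ (searchNetwork Ψ mcost η t X Γ l i) := by
  induction l generalizing i with
  | zero => exact fun _ _ _ _ hp => absurd hp.symm (Option.some_ne_none _)
  | succ l ih => exact isSound_searchGraph (ih (i + 1)) _ _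

theorem run_sound [Fintype N] [DecidableEq N] [Fintype H] [Fintype K]
    {Γ : GraphNetwork Ψ.toTaskDomain N H K} {l : ℕ} (hq₀ : Ψ.q₀ ∈ Ψ.φ Ψ.s₀) {p : TMPlan A d}
    (hp : run Ψ Γ mcost η X l t = some p) : Ψ.IsSolution p :=
  have ⟨hcompl, hne⟩ := isSound_searchNetwork l 0 hp
  hcompl.isSolution_startAt hne hq₀

end Soundness

/-! ### Completeness of the search -/

section Completeness

variable {S A : Type*} {d : ℕ} {N H K : Type*} {Ψ : TaskMotionDomain S A d}
  {mcost : Traj d → ℝ} {η : ℝ} {t b n : ℕ} {X : List ℕ → ℕ → Conf d}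
  {good : (ℕ → Conf d) → Prop}

/-- A sequence of actions with regions `R₁, R₂, …` is a funnel from the state `s` and the region
`R₀ = R` if, whenever the samples are good, RRT leads from every configuration of a region to the
next region, by a motion plan for the action in between. -/
def IsFunnel (Ψ : TaskMotionDomain S A d) (η : ℝ) (t : ℕ) (good : (ℕ → Conf d) → Prop) :
    S → Set (Conf d) → List (A × Set (Conf d)) → Prop
  | _, _, [] => True
  | s, R, (a, R') :: p =>
    (∀ q ∈ R, ∀ x, good x → ∃ τ ∈ RRT.plans (Ψ.motionDomain s q a) η x t, τ 1 ∈ R') ∧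
      IsFunnel Ψ η t good (Ψ.γ s a) R' p

/-- The call identified by `w`, and all calls made at most `n` choices later with each choice being
at most `b`, have good samples. -/
def GoodCalls {α : Type*} (good : α → Prop) (X : List ℕ → α) (b : ℕ) : ℕ → List ℕ → Prop
  | 0, w => good (X w)
  | n + 1, w => good (X w) ∧ ∀ j ≤ b, GoodCalls good X b n (j :: w)

theorem GoodCalls.head {α : Type*} {good : α → Prop} {X : List ℕ → α} {w : List ℕ}
    (h : GoodCalls good X b n w) : good (X w) := by
  cases n with
  | zero => exact h
  | succ n => exact h.1

theorem GoodCalls.mono {α : Type*} {good : α → Prop} {X : List ℕ → α} {n' : ℕ} (hn : n' ≤ n)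
    {w : List ℕ} (h : GoodCalls good X b n w) : GoodCalls good X b n' w := by
  induction n' generalizing n w with
  | zero => exact h.head
  | succ n' ih =>
    obtain ⟨n, rfl⟩ : ∃ k, n = k + 1 := Nat.exists_eq_add_of_le' (Nat.one_le_of_lt hn)
    exact ⟨h.1, fun j hj => ih (Nat.le_of_succ_le_succ hn) (h.2 j hj)⟩

/-- The search `F` from the state `s` succeeds if it starts in a region from which `p` is a funnel
and the samples are good for `n` more choices. -/
def SucceedsAlong (Ψ : TaskMotionDomain S A d) (η : ℝ) (t : ℕ) (good : (ℕ → Conf d) → Prop)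
    (X : List ℕ → ℕ → Conf d) (b n : ℕ) (s : S) (p : List (A × Set (Conf d)))
    (F : Conf d → List ℕ → Option (TMPlan A d)) : Prop :=
  ∀ ⦃R q w⦄, IsFunnel Ψ η t good s R p → q ∈ R → GoodCalls good X b n w → (F q w).isSome

theorem SucceedsAlong.mono {n' : ℕ} {s : S} {p : List (A × Set (Conf d))}
    {F : Conf d → List ℕ → Option (TMPlan A d)} (hn : n ≤ n')
    (h : SucceedsAlong Ψ η t good X b n s p F) : SucceedsAlong Ψ η t good X b n' s p F :=
  fun _ _ _ hfunnel hq hw => h hfunnel hq (hw.mono hn)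

theorem succeedsAlong_simulate (htb : t ≤ b)
    {cont : S → Conf d → List ℕ → Option (TMPlan A d)} {p₁ p₂ : List (A × Set (Conf d))} {s : S}
    (hcont : SucceedsAlong Ψ η t good X b n ((p₁.map Prod.fst).foldl Ψ.γ s) p₂
      (cont ((p₁.map Prod.fst).foldl Ψ.γ s))) :
    SucceedsAlong Ψ η t good X b (p₁.length + n) s (p₁ ++ p₂)
      (simulate Ψ mcost η t X cont (p₁.map Prod.fst) s) := by
  induction p₁ generalizing s with
  | nil => exact hcont.mono (Nat.le_add_left n 0)
  | cons aR p₁ ih =>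
    rintro R q w ⟨hR, hfunnel⟩ hq hw
    rw [List.length_cons, Nat.add_right_comm] at hw
    obtain ⟨τ, hτ, hτR⟩ := hR q hq (X w) hw.1
    obtain ⟨j, hj, hmem⟩ := exists_mem_ranked mcost hτ
    have hjb : j ≤ b :=
      (Nat.le_of_lt_succ (hj.trans_le (RRT.length_plans_le _ η (X w) t))).trans htb
    refine List.findSome?_isSome_iff.2 ⟨(τ, j), hmem, ?_⟩
    rw [Option.isSome_map]
    exact ih hcont hfunnel hτR (hw.2 j hjb)

theorem succeedsAlong_searchGraph_of_feasible [DecidableEq N] [Fintype H] [Fintype K] (htb : t ≤ b)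
    (hcard : Fintype.card (H ⊕ K) ≤ b) {G : TaskGraph Ψ.toTaskDomain N H K}
    {next : S → Conf d → List ℕ → Option (TMPlan A d)} {k : ℕ} {ach : Finset (Option N)} {s : S}
    {h : H ⊕ K} (hf : G.Feasible ach s h) {p₁ p₂ : List (A × Set (Conf d))}
    (hp₁ : p₁.map Prod.fst = G.acts h)
    (hcont : SucceedsAlong Ψ η t good X b n ((G.acts h).foldl Ψ.γ s) p₂
      (afterArc G next (searchGraph Ψ mcost η t X G next k) ach h ((G.acts h).foldl Ψ.γ s))) :
    SucceedsAlong Ψ η t good X b (p₁.length + n + 1) s (p₁ ++ p₂)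
      (searchGraph Ψ mcost η t X G next (k + 1) ach s) := by
  classical
  intro R q w hfunnel hq hw
  rw [searchGraph_succ_of_feasible ⟨h, hf⟩, Option.isSome_or, Bool.or_eq_true]
  left
  have hmem : h ∈ (Finset.univ.filter fun h => G.Feasible ach s h).toList := by
    simpa only [Finset.mem_toList, Finset.mem_filter, Finset.mem_univ, true_and] using hf
  obtain ⟨j, hj, hjmem⟩ := exists_mem_ranked G.cost hmem
  have hjb : j + 1 ≤ b := by
    rw [Finset.length_toList] at hj
    exact (Nat.succ_le_of_lt (hj.trans_le (Finset.card_le_univ _))).trans hcard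
  refine List.findSome?_isSome_iff.2 ⟨(h, j), by convert hjmem, ?_⟩
  rw [← hp₁] at hcont ⊢
  exact succeedsAlong_simulate htb hcont hfunnel hq (hw.2 (j + 1) hjb)

theorem succeedsAlong_searchGraph_of_next [DecidableEq N] [Fintype H] [Fintype K]
    {G : TaskGraph Ψ.toTaskDomain N H K} {next : S → Conf d → List ℕ → Option (TMPlan A d)}
    {k : ℕ} {ach : Finset (Option N)} {s : S} (hex : ∃ h, G.Feasible ach s h)
    {p : List (A × Set (Conf d))} (hnext : SucceedsAlong Ψ η t good X b n s p (next s)) :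
    SucceedsAlong Ψ η t good X b (n + 1) s p
      (searchGraph Ψ mcost η t X G next (k + 1) ach s) := by
  intro R q w hfunnel hq hw
  rw [searchGraph_succ_of_feasible hex, Option.isSome_or, Bool.or_eq_true]
  exact Or.inr (hnext hfunnel hq (hw.2 0 (Nat.zero_le b)))

theorem succeedsAlong_searchGraph [Fintype N] [DecidableEq N] [Fintype H] [Fintype K] (htb : t ≤ b)
    (hcard : Fintype.card (H ⊕ K) ≤ b) {Γ : GraphNetwork Ψ.toTaskDomain N H K} {i m : ℕ}
    {ach : Finset (Option N)} {s : S} {as : List A} (hs : Γ.SolvedBy i m ach s as)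
    {p : List (A × Set (Conf d))} (hp : p.map Prod.fst = as) {l k : ℕ} (hml : m ≤ l + 1)
    (hk : Fintype.card N + 1 = k + ach.card) :
    SucceedsAlong Ψ η t good X b (p.length + k + m * Fintype.card N) s p
      (searchGraph Ψ mcost η t X (Γ i) (searchNetwork Ψ mcost η t X Γ l (i + 1)) k ach s) := by
  induction hs generalizing p l k with
  | @success i m ach s h hf hsucc hsat =>
    obtain ⟨k, rfl⟩ := hf.exists_eq_succ hk
    rw [← p.append_nil]
    refine (succeedsAlong_searchGraph_of_feasible (n := 0) htb hcard hf hp ?_).mono ?_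
    · rw [afterArc_of_isSuccess hsat hsucc]
      exact fun _ _ _ _ _ _ => rfl
    · rw [List.append_nil]
      omega
  | @failure i m ach s as h hf hfail hsat hrest ih =>
    obtain ⟨k, rfl⟩ := hf.exists_eq_succ hk
    obtain ⟨l, rfl⟩ : ∃ l', l = l' + 1 :=
      Nat.exists_eq_add_of_le' (hrest.pos.trans_le (Nat.le_of_succ_le_succ hml))
    obtain ⟨p₁, p₂, rfl, hp₁, hp₂⟩ := List.map_eq_append_iff.1 hp
    refine (succeedsAlong_searchGraph_of_feasible
      (n := p₂.length + Fintype.card N + m * Fintype.card N) htb hcard hf hp₁ ?_).mono ?_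
    · rw [afterArc_of_isFailure hsat hfail]
      exact ih hp₂ (Nat.le_of_succ_le_succ hml) rfl
    · rw [List.length_append, Nat.succ_mul]
      omega
  | @step i m ach s as h hf hsucc hfail hsat _ ih =>
    obtain ⟨k, rfl⟩ := hf.exists_eq_succ hk
    obtain ⟨p₁, p₂, rfl, hp₁, hp₂⟩ := List.map_eq_append_iff.1 hp
    refine (succeedsAlong_searchGraph_of_feasible
      (n := p₂.length + k + (m + 1) * Fintype.card N) htb hcard hf hp₁ ?_).mono ?_
    · rw [afterArc_of_not hsat hsucc hfail]
      refine ih hp₂ hml ?_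
      rw [hk, Finset.card_insert_of_notMem hf.2]
      omega
    · rw [List.length_append]
      omega
  | @retry i m ach s as hex hrest ih =>
    obtain ⟨k, rfl⟩ := hex.choose_spec.exists_eq_succ hk
    obtain ⟨l, rfl⟩ : ∃ l', l = l' + 1 :=
      Nat.exists_eq_add_of_le' (hrest.pos.trans_le (Nat.le_of_succ_le_succ hml))
    refine (succeedsAlong_searchGraph_of_next hex
      (ih hp (Nat.le_of_succ_le_succ hml) rfl)).mono ?_
    rw [Nat.succ_mul]
    omega

theorem run_isSome [Fintype N] [DecidableEq N] [Fintype H] [Fintype K] (htb : t ≤ b)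
    (hcard : Fintype.card (H ⊕ K) ≤ b) {Γ : GraphNetwork Ψ.toTaskDomain N H K}
    {p : List (A × Set (Conf d))} {l₀ l : ℕ} (hl : l₀ ≤ l)
    (hp : Γ.ContainsPlan l₀ (p.map Prod.fst)) {R : Set (Conf d)}
    (hfunnel : IsFunnel Ψ η t good Ψ.s₀ R p) (hq₀ : Ψ.q₀ ∈ R)
    (hX : GoodCalls good X b (p.length + (l₀ + 1) * Fintype.card N) []) :
    (run Ψ Γ mcost η X l t).isSome := by
  obtain ⟨l, rfl⟩ : ∃ l', l = l' + 1 := Nat.exists_eq_add_of_le' (hp.pos.trans_le hl)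
  refine succeedsAlong_searchGraph htb hcard hp rfl hl rfl hfunnel hq₀ ?_
  rwa [Nat.add_assoc, Nat.add_comm (Fintype.card N), ← Nat.succ_mul]

end Completeness

/-! ### Following a plan with clearance -/

section Following

variable {S A : Type*} {d : ℕ} {Ψ : TaskMotionDomain S A d}

/-- The `k`-th of the points that divide the trajectory `τ` into `m` pieces. For `k > m` it is the
end point of `τ`. -/
noncomputable def wayPoint {E : Type*} [TopologicalSpace E] (τ : C(unitInterval, E))
    (m k : ℕ) : E :=
  τ (Set.projIcc 0 1 zero_le_one ((k : ℝ) / m))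

theorem wayPoint_zero {E : Type*} [TopologicalSpace E] (τ : C(unitInterval, E)) (m : ℕ) :
    wayPoint τ m 0 = τ 0 := by
  rw [wayPoint, Nat.cast_zero, zero_div, Set.projIcc_left]
  rfl

theorem wayPoint_self {E : Type*} [TopologicalSpace E] (τ : C(unitInterval, E)) {m : ℕ}
    (hm : 0 < m) : wayPoint τ m m = τ 1 := by
  rw [wayPoint, div_self (Nat.cast_ne_zero.2 hm.ne'), Set.projIcc_right]
  rfl

theorem eventually_dist_wayPoint_le {E : Type*} [PseudoMetricSpace E] (τ : C(unitInterval, E))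
    {r : ℝ} (hr : 0 < r) :
    ∀ᶠ m : ℕ in atTop, ∀ k, dist (wayPoint τ m k) (wayPoint τ m (k + 1)) ≤ r := by
  obtain ⟨ε, hε, h⟩ := Metric.uniformContinuous_iff.1
    (CompactSpace.uniformContinuous_of_continuous τ.continuous) r hr
  have hlim : ∀ᶠ m : ℕ in atTop, 1 / (m : ℝ) < ε :=
    tendsto_one_div_atTop_nhds_zero_nat.eventually (gt_mem_nhds hε)
  filter_upwards [hlim] with m hm k
  refine (h (lt_of_le_of_lt ?_ hm)).le
  calc |((Set.projIcc 0 1 zero_le_one ((k : ℝ) / m) : unitInterval) : ℝ) -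
          (Set.projIcc 0 1 zero_le_one (((k + 1 : ℕ) : ℝ) / m) : unitInterval)|
      ≤ |(k : ℝ) / m - ((k + 1 : ℕ) : ℝ) / m| := Set.abs_projIcc_sub_projIcc _
    _ = 1 / m := by rw [← sub_div, abs_div, Nat.cast_succ]; simp

theorem exists_mem_plans_of_visits (hC : Convex ℝ Ψ.C) {η r δ : ℝ} (hrη : 3 * r ≤ η)
    (hrδ : 4 * r < δ) {s : S} {a : A} {τ : Traj d}
    (hfree : ∀ u, Metric.ball (τ u) δ ∩ Ψ.C ⊆ Ψ.free ∩ Ψ.ξ a)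
    (hgoal : Metric.ball (τ 1) δ ∩ Ψ.C ⊆ Ψ.φ (Ψ.γ s a)) {m k t : ℕ} (hm : 0 < m)
    (hmk : m * k ≤ t) (hstep : ∀ j, dist (wayPoint τ m j) (wayPoint τ m (j + 1)) ≤ r)
    {q : Conf d} (hq : q ∈ Metric.ball (τ 0) r ∩ Ψ.C) {x : ℕ → Conf d} (hxC : ∀ i, x i ∈ Ψ.C)
    (hx : RRT.Visits (fun j => Metric.ball (wayPoint τ m (j + 1)) r) m k x) :
    ∃ σ ∈ RRT.plans (Ψ.motionDomain s q a) η x t, σ 1 ∈ Metric.ball (τ 1) r ∩ Ψ.C := by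
  have hr : 0 < r := Metric.pos_of_mem_ball hq.1
  obtain ⟨v, hv, hvr⟩ := RRT.exists_mem_tree_of_visits (M := Ψ.motionDomain s q a) hC hrη hrδ
    (fun j _ => hstep j) (fun j _ y hy => ⟨hy.2, (hfree _ hy).1.2, (hfree _ hy).2⟩) hq.2
    ((wayPoint_zero τ m).symm ▸ hq.1) hxC hx
  have hvr : dist v.pt (τ 1) < r := wayPoint_self τ hm ▸ hvr
  have hvC : v.pt ∈ Ψ.C := (RRT.pt_mem_free hv).1
  obtain ⟨σ, hσ, hσv⟩ := RRT.exists_mem_plans (RRT.tree_subset_tree _ η x hmk hv)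
    (hgoal ⟨Metric.mem_ball.2 (by linarith), hvC⟩)
  exact ⟨σ, hσ, hσv ▸ ⟨hvr, hvC⟩⟩

/-- For each trajectory of the plan `p`, cut into `m` pieces, the samples `x` from `C` visit the
`r`-balls around its way points one after the other, with `k` samples for each of them. -/
structure GoodSamples (C : Set (Conf d)) (r : ℝ) (m : ℕ) (p : TMPlan A d) (k : ℕ)
    (x : ℕ → Conf d) : Prop where
  mem : ∀ i, x i ∈ C
  visits : ∀ aτ ∈ p, RRT.Visits (fun j => Metric.ball (wayPoint aτ.2 m (j + 1)) r) m k x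

theorem isFunnel_of_isClear (hC : Convex ℝ Ψ.C) {η r δ : ℝ} (hrη : 3 * r ≤ η) (hrδ : 4 * r < δ)
    {m k t : ℕ} (hm : 0 < m) (hmk : m * k ≤ t) {s : S} {c : Conf d} {p : TMPlan A d}
    (hstart : ∀ h : 0 < p.length, p[0].2 0 = c)
    (hglue : ∀ (i : ℕ) (h : i + 1 < p.length), p[i + 1].2 0 = p[i].2 1)
    (hclear : (Ψ.startAt s c).IsClear δ p)
    (hstep : ∀ aτ ∈ p, ∀ j, dist (wayPoint aτ.2 m j) (wayPoint aτ.2 m (j + 1)) ≤ r)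
    {good : (ℕ → Conf d) → Prop} (hgood : ∀ x, good x → GoodSamples Ψ.C r m p k x) :
    IsFunnel Ψ η t good s (Metric.ball c r ∩ Ψ.C)
      (p.map fun aτ => (aτ.1, Metric.ball (aτ.2 1) r ∩ Ψ.C)) := by
  induction p generalizing s c with
  | nil => trivial
  | cons aτ p ih =>
    constructor
    · intro q hq x hx
      obtain ⟨hfree, hgoal⟩ := hclear 0 (Nat.succ_pos _)
      exact exists_mem_plans_of_visits hC hrη hrδ hfree hgoal hm hmk
        (hstep aτ List.mem_cons_self) (hstart (Nat.succ_pos _) ▸ hq) (hgood x hx).mem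
        ((hgood x hx).visits aτ List.mem_cons_self)
    · exact ih (fun h => hglue 0 (Nat.succ_lt_succ h))
        (fun i h => hglue (i + 1) (Nat.succ_lt_succ h))
        (fun i h => hclear (i + 1) (Nat.succ_lt_succ h))
        (fun aτ h => hstep aτ (List.mem_cons_of_mem _ h))
        fun x hx => ⟨(hgood x hx).mem,
          fun aτ h => (hgood x hx).visits aτ (List.mem_cons_of_mem _ h)⟩

theorem finds_of_goodCalls {N H K : Type*} [Fintype N] [DecidableEq N] [Fintype H] [Fintype K]
    {Γ : GraphNetwork Ψ.toTaskDomain N H K} (hC : Convex ℝ Ψ.C) {η r δ : ℝ} (hr : 0 < r)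
    (hrη : 3 * r ≤ η) (hrδ : 4 * r < δ) {p : TMPlan A d} {l₀ l : ℕ} (hl : l₀ ≤ l)
    (hplan : Γ.ContainsPlan l₀ (p.map Prod.fst)) (hp : Ψ.IsSolution p) (hclear : Ψ.IsClear δ p)
    {m : ℕ} (hm : 0 < m)
    (hstep : ∀ aτ ∈ p, ∀ j, dist (wayPoint aτ.2 m j) (wayPoint aτ.2 m (j + 1)) ≤ r)
    {mcost : Traj d → ℝ} {X : List ℕ → ℕ → Conf d} {t : ℕ}
    (hX : GoodCalls (GoodSamples Ψ.C r m p (t / m)) X (t + Fintype.card (H ⊕ K))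
      (p.length + (l₀ + 1) * Fintype.card N) []) :
    Finds Ψ Γ mcost η X l t := by
  have hlen : 0 < p.length := List.length_pos_iff.2 hp.ne_nil
  have hq₀ : Ψ.q₀ ∈ Ψ.φ Ψ.s₀ := hp.start hlen ▸ hp.source 0 hlen
  have hq₀C : Ψ.q₀ ∈ Ψ.C := hp.start hlen ▸ (hp.free 0 hlen 0).1
  have hfunnel := isFunnel_of_isClear (s := Ψ.s₀) (c := Ψ.q₀) hC hrη hrδ hm (Nat.mul_div_le t m)
    hp.start hp.glue hclear hstep (good := GoodSamples Ψ.C r m p (t / m)) fun _ hx => hx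
  obtain ⟨p', hp'⟩ := Option.isSome_iff_exists.1 <| run_isSome (mcost := mcost)
    (Nat.le_add_right t (Fintype.card (H ⊕ K))) (Nat.le_add_left _ t) hl
    (by simpa only [List.map_map, Function.comp_def] using hplan) hfunnel
    ⟨Metric.mem_ball_self hr, hq₀C⟩ (by rwa [List.length_map])
  exact ⟨p', hp', run_sound hq₀ hp'⟩

end Following

/-! ### Probability of failure -/

section Probability

variable {Ω : Type*} [MeasurableSpace Ω] {P : Measure Ω}

theorem measure_not_visits_le {E : Type*} [MeasurableSpace E] {Y : ℕ → Ω → E}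
    (hY : iIndepFun Y P) {U : ℕ → Set E} (hU : ∀ k, MeasurableSet (U k)) {ρ : ENNReal} {m : ℕ}
    (hρ : ∀ k < m, ∀ n, P (Y n ⁻¹' (U k)ᶜ) ≤ ρ) (s : ℕ) :
    P {ω | ¬ RRT.Visits U m s fun n => Y n ω} ≤ m * ρ ^ s := by
  have hsub : {ω | ¬ RRT.Visits U m s fun n => Y n ω} ⊆
      ⋃ k ∈ Finset.range m, ⋂ i ∈ Finset.Ico (k * s) ((k + 1) * s), Y i ⁻¹' (U k)ᶜ := by
    intro ω hω
    simp only [RRT.Visits, Set.mem_ofPred_eq, not_forall, not_exists, not_and] at hω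
    obtain ⟨k, hk, hω⟩ := hω
    exact Set.mem_biUnion (Finset.mem_coe.2 (Finset.mem_range.2 hk)) (Set.mem_iInter₂.2 hω)
  have hblock : ∀ k ∈ Finset.range m,
      P (⋂ i ∈ Finset.Ico (k * s) ((k + 1) * s), Y i ⁻¹' (U k)ᶜ) ≤ ρ ^ s := by
    intro k hk
    have hcard : (Finset.Ico (k * s) ((k + 1) * s)).card = s := by
      rw [Nat.card_Ico, ← Nat.sub_mul, Nat.add_sub_cancel_left, one_mul]
    rw [hY.measure_inter_preimage_eq_mul _ fun i _ => (hU k).compl]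
    refine (Finset.prod_le_pow_card _ _ ρ fun i _ => hρ k (Finset.mem_range.1 hk) i).trans ?_
    rw [hcard]
  calc P {ω | ¬ RRT.Visits U m s fun n => Y n ω}
      ≤ ∑ k ∈ Finset.range m, P (⋂ i ∈ Finset.Ico (k * s) ((k + 1) * s), Y i ⁻¹' (U k)ᶜ) :=
        (measure_mono hsub).trans (measure_biUnion_finset_le _ _)
    _ ≤ (Finset.range m).card • ρ ^ s := Finset.sum_le_card_nsmul _ _ _ hblock
    _ = m * ρ ^ s := by rw [Finset.card_range, nsmul_eq_mul]

theorem measure_not_goodSamples_le {A : Type*} {d : ℕ} {C : Set (Conf d)} {ν : Measure (Conf d)}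
    (hνC : ∀ᵐ q ∂ν, q ∈ C) {p : TMPlan A d} {r : ℝ} {ρ : ENNReal}
    (hρ : ∀ aτ ∈ p, ∀ u, ν (Metric.ball (aτ.2 u) r)ᶜ ≤ ρ) {Y : ℕ → Ω → Conf d}
    (hlaw : ∀ n, HasLaw (Y n) ν P) (hindep : iIndepFun Y P) (m s : ℕ) :
    P {ω | ¬ GoodSamples C r m p s fun n => Y n ω} ≤ (p.length * m : ℕ) * ρ ^ s := by
  classical
  have hmem : ∀ᵐ ω ∂P, ∀ n, Y n ω ∈ C := ae_all_iff.2 fun n =>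
    ae_of_ae_map (hlaw n).aemeasurable ((hlaw n).map_eq.symm ▸ hνC)
  have hsub : {ω | ¬ GoodSamples C r m p s fun n => Y n ω} ≤ᵐ[P]
      (⋃ aτ ∈ p.toFinset, {ω | ¬ RRT.Visits
        (fun k => Metric.ball (wayPoint aτ.2 m (k + 1)) r) m s fun n => Y n ω} : Set Ω) := by
    filter_upwards [hmem] with ω hω hbad
    refine Set.mem_iUnion₂.2 ?_
    by_contra! hvisits
    exact hbad ⟨hω, fun aτ haτ => not_not.1 (hvisits aτ (List.mem_toFinset.2 haτ))⟩
  have hplan : ∀ aτ ∈ p.toFinset, P {ω | ¬ RRT.Visits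
      (fun k => Metric.ball (wayPoint aτ.2 m (k + 1)) r) m s fun n => Y n ω} ≤ m * ρ ^ s := by
    refine fun aτ haτ => measure_not_visits_le hindep (fun _ => measurableSet_ball)
      (fun k _ n => ?_) s
    rw [← Measure.map_apply_of_aemeasurable (hlaw n).aemeasurable measurableSet_ball.compl,
      (hlaw n).map_eq]
    exact hρ aτ (List.mem_toFinset.1 haτ) _
  refine (measure_mono_ae hsub).trans ((measure_biUnion_finset_le _ _).trans ?_)
  refine (Finset.sum_le_card_nsmul _ _ _ hplan).trans ?_
  rw [nsmul_eq_mul, ← mul_assoc, Nat.cast_mul]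
  gcongr
  exact List.toFinset_card_le p

theorem measure_not_goodCalls_le {α : Type*} {good : α → Prop} {X : List ℕ → Ω → α} {ε : ENNReal}
    (h : ∀ w, P {ω | ¬ good (X w ω)} ≤ ε) (b n : ℕ) (w : List ℕ) :
    P {ω | ¬ GoodCalls good (fun w => X w ω) b n w} ≤ ((b + 2 : ℕ) : ENNReal) ^ n * ε := by
  induction n generalizing w with
  | zero => simpa only [GoodCalls, pow_zero, one_mul] using h w
  | succ n ih =>
    have hsub : {ω | ¬ GoodCalls good (fun w => X w ω) b (n + 1) w} ⊆ {ω | ¬ good (X w ω)} ∪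
        ⋃ j ∈ Finset.range (b + 1), {ω | ¬ GoodCalls good (fun w => X w ω) b n (j :: w)} := by
      intro ω hω
      by_contra hgood
      simp only [Set.mem_union, Set.mem_iUnion, Finset.mem_range, Nat.lt_succ_iff,
        Set.mem_ofPred_eq, not_or, not_exists, not_not] at hgood
      exact hω hgood
    have hone : (1 : ENNReal) ≤ ((b + 2 : ℕ) : ENNReal) ^ n :=
      one_le_pow₀ (by exact_mod_cast Nat.succ_pos (b + 1))
    calc P {ω | ¬ GoodCalls good (fun w => X w ω) b (n + 1) w}
        ≤ P {ω | ¬ good (X w ω)} + ∑ j ∈ Finset.range (b + 1),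
            P {ω | ¬ GoodCalls good (fun w => X w ω) b n (j :: w)} :=
          (measure_mono hsub).trans ((measure_union_le _ _).trans
            (add_le_add_right (measure_biUnion_finset_le _ _) _))
      _ ≤ 1 * ε + (b + 1 : ℕ) * (((b + 2 : ℕ) : ENNReal) ^ n * ε) := by
          refine add_le_add ((h w).trans (one_mul ε).ge)
            ((Finset.sum_le_card_nsmul _ _ _ fun j _ => ih (j :: w)).trans ?_)
          rw [Finset.card_range, nsmul_eq_mul]
      _ ≤ ((b + 2 : ℕ) : ENNReal) ^ n * ε + (b + 1 : ℕ) * (((b + 2 : ℕ) : ENNReal) ^ n * ε) := by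
          gcongr
      _ = ((b + 2 : ℕ) : ENNReal) ^ (n + 1) * ε := by
          push_cast
          ring

theorem exists_measure_not_finds_le {S A N H K : Type*} {d : ℕ} [Fintype N] [DecidableEq N]
    [Fintype H] [Fintype K] [IsProbabilityMeasure P] {Ψ : TaskMotionDomain S A d}
    {Γ : GraphNetwork Ψ.toTaskDomain N H K} (hconv : Convex ℝ Ψ.C) {mcost : Traj d → ℝ} {η : ℝ}
    (hη : 0 < η) {X : List ℕ → ℕ → Ω → Conf d} {ν : Measure (Conf d)} (hνC : ∀ᵐ q ∂ν, q ∈ Ψ.C)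
    (hνsupp : Ψ.C ⊆ ν.support) (hlaw : ∀ w n, HasLaw (X w n) ν P)
    (hindep : ∀ w, iIndepFun (X w) P) {l₀ : ℕ} {p : TMPlan A d}
    (hplan : Γ.ContainsPlan l₀ (p.map Prod.fst)) (hp : Ψ.IsSolution p)
    (hclear : Ψ.HasClearance p) :
    ∃ c n b m : ℕ, ∃ ρ < (1 : ENNReal), 0 < m ∧ ∀ l ≥ l₀, ∀ t,
      P {ω | ¬ Finds Ψ Γ mcost η (fun w n => X w n ω) l t} ≤
        c * (((t + b : ℕ) : ENNReal) ^ n * ρ ^ (t / m)) := by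
  have : IsProbabilityMeasure ν := (hlaw [] 0).isProbabilityMeasure_iff.1 inferInstance
  obtain ⟨δ, hδ, hclear⟩ := hclear
  obtain ⟨r, hr, hrη, hrδ⟩ : ∃ r : ℝ, 0 < r ∧ 3 * r ≤ η ∧ 4 * r < δ :=
    ⟨min (η / 3) (δ / 5), by positivity, by linarith [min_le_left (η / 3) (δ / 5)],
      by linarith [min_le_right (η / 3) (δ / 5)]⟩
  obtain ⟨ρ, hρ, hball⟩ : ∃ ρ < (1 : ENNReal), ∀ aτ ∈ p, ∀ u,
      ν (Metric.ball (aτ.2 u) r)ᶜ ≤ ρ := by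
    have hsupp : ⋃ aτ ∈ {aτ | aτ ∈ p}, Set.range aτ.2 ⊆ ν.support := Set.iUnion₂_subset
      fun aτ haτ => (Set.range_subset_iff.2 (hp.mem_C haτ)).trans hνsupp
    obtain ⟨ρ, hρ, hball⟩ := exists_lt_one_measure_compl_ball_le
      ((List.finite_toSet p).isCompact_biUnion fun aτ _ => isCompact_range aτ.2.continuous) hsupp hr
    exact ⟨ρ, hρ, fun aτ haτ u => hball _ (Set.mem_biUnion haτ ⟨u, rfl⟩)⟩
  obtain ⟨m, hstep, hm⟩ := (((eventually_all_finite (List.finite_toSet p)).2 fun aτ _ =>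
    eventually_dist_wayPoint_le aτ.2 hr).and (eventually_gt_atTop 0)).exists
  refine ⟨p.length * m, p.length + (l₀ + 1) * Fintype.card N, Fintype.card (H ⊕ K) + 2, m, ρ, hρ,
    hm, fun l hl t => ?_⟩
  rw [mul_left_comm]
  refine (measure_mono (Set.ofPred_subset_ofPred.2 fun ω => mt fun hgood => ?_)).trans
    (measure_not_goodCalls_le (good := GoodSamples Ψ.C r m p (t / m)) (fun w =>
      measure_not_goodSamples_le hνC hball (hlaw w) (hindep w) m (t / m))
      (t + Fintype.card (H ⊕ K)) _ [])
  exact finds_of_goodCalls hconv hr hrη hrδ hl hplan hp hclear hm hstep hgood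

end Probability

end TMPIDAN

theorem mainTheorem1_general {S A N H K : Type*} {d : ℕ} [Fintype N] [DecidableEq N]
    [Fintype H] [Fintype K]
    (Ψ : TaskMotionDomain S A d) (Γ : GraphNetwork Ψ.toTaskDomain N H K)
    (hconv : Convex ℝ Ψ.C)
    (mcost : Traj d → ℝ) (η : ℝ) (hη : 0 < η)
    {Ω : Type*} [MeasurableSpace Ω] (P : Measure Ω) [IsProbabilityMeasure P]
    (X : List ℕ → ℕ → Ω → Conf d)
    (ν : Measure (Conf d)) (hνC : ∀ᵐ q ∂ν, q ∈ Ψ.C) (hνsupp : Ψ.C ⊆ ν.support)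
    (hlaw : ∀ w n, HasLaw (X w n) ν P) (hindep : ∀ w, iIndepFun (X w) P)
    (hsol : ∃ (l : ℕ) (p : TMPlan A d),
      Γ.ContainsPlan l (p.map Prod.fst) ∧ Ψ.IsSolution p ∧ Ψ.HasClearance p) :
    Tendsto (fun k : ℕ × ℕ =>
        P {ω | TMPIDAN.Finds Ψ Γ mcost η (fun w n => X w n ω) k.1 k.2})
      (atTop ×ˢ atTop) (𝓝 1) ∧
    Tendsto (fun k : ℕ × ℕ =>
        P {ω | ¬ TMPIDAN.Finds Ψ Γ mcost η (fun w n => X w n ω) k.1 k.2})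
      (atTop ×ˢ atTop) (𝓝 0) := by
  obtain ⟨l₀, p, hplan, hp, hclear⟩ := hsol
  obtain ⟨c, n, b, m, ρ, hρ, hm, hle⟩ := TMPIDAN.exists_measure_not_finds_le (mcost := mcost) hconv
    hη hνC hνsupp hlaw hindep hplan hp hclear
  have hbound : Tendsto (fun t : ℕ => c * (((t + b : ℕ) : ENNReal) ^ n * ρ ^ (t / m)))
      atTop (𝓝 0) := by
    simpa only [mul_zero] using ENNReal.Tendsto.const_mul
      (tendsto_natCast_add_pow_mul_pow_div_zero hρ n b hm)
      (Or.inr (ENNReal.natCast_ne_top c))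
  have hfail : Tendsto (fun k : ℕ × ℕ =>
      P {ω | ¬ TMPIDAN.Finds Ψ Γ mcost η (fun w n => X w n ω) k.1 k.2}) (atTop ×ˢ atTop) (𝓝 0) :=
    tendsto_of_tendsto_of_tendsto_of_le_of_le' tendsto_const_nhds (hbound.comp tendsto_snd)
      (Eventually.of_forall fun _ => zero_le)
      ((tendsto_fst.eventually (eventually_ge_atTop l₀)).mono fun k hk => hle k.1 hk k.2)
  exact ⟨tendsto_measure_one_of_tendsto_measure_compl_zero hfail, hfail⟩

theorem mainTheorem1 {S A N H K : Type*} {d : ℕ} [Fintype N] [DecidableEq N] [Fintype H] [Fintype K]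
    (Ψ : TaskMotionDomain S A d) (Γ : GraphNetwork Ψ.toTaskDomain N H K)
    (hconv : Convex ℝ Ψ.C) (hbdd : Bornology.IsBounded Ψ.C) (hint : (interior Ψ.C).Nonempty)
    (mcost : Traj d → ℝ) (η : ℝ) (hη : 0 < η)
    {Ω : Type*} [MeasurableSpace Ω] (P : Measure Ω) [IsProbabilityMeasure P]
    (X : List ℕ → ℕ → Ω → Conf d)
    (hmeas : ∀ w n, Measurable (X w n))
    (hindep : iIndepFun (fun k : List ℕ × ℕ => X k.1 k.2) P)
    (hunif : ∀ w n, P.map (X w n) = volume[|Ψ.C])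
    (hsol : ∃ (l : ℕ) (p : TMPlan A d),
      Γ.ContainsPlan l (p.map Prod.fst) ∧ Ψ.IsSolution p ∧ Ψ.HasClearance p) :
    Tendsto (fun k : ℕ × ℕ =>
        P {ω | TMPIDAN.Finds Ψ Γ mcost η (fun w n => X w n ω) k.1 k.2})
      (atTop ×ˢ atTop) (𝓝 1) ∧
    Tendsto (fun k : ℕ × ℕ =>
        P {ω | ¬ TMPIDAN.Finds Ψ Γ mcost η (fun w n => X w n ω) k.1 k.2})
      (atTop ×ˢ atTop) (𝓝 0) :=
  mainTheorem1_general Ψ Γ hconv mcost η hη P X (volume[|Ψ.C])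
    (ae_cond_mem₀ (hconv.nullMeasurableSet volume))
    (subset_support_cond_of_convex hconv hint hbdd.measure_lt_top.ne)
    (fun w n => ⟨(hmeas w n).aemeasurable, hunif w n⟩)
    (fun w => hindep.precomp (g := fun k => (w, k)) (Prod.mk_right_injective w)) hsol
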